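/- For a set $T \subset \mathbb{R}^n$, let $\omega(T) = \mathbb{E}_{g}\big[\sup_{v \in T} \langle g, v\rangle\big]$ denote its Gaussian width, where $g \in \mathbb{R}^n$ is a vector of $n$ independent standard normal variables (with the convention $\sup\emptyset = 0$). Let $\epsilon$ be a real number, let $X \subset \mathcal{S}^{m-1} = \{x \in \mathbb{R}^m : \|x\| = 1\}$ be a finite set, and let $S \subset \mathbb{R}^d$ be an $\epsilon$-isometric embedding of $X$, that is, $S = \psi(X)$ for a map $\psi : X \to \mathbb{R}^d$ such that $$(1-\epsilon)\|x - y\| \le \|\psi(x) - \psi(y)\| \le (1+\epsilon)\|x - y\| \qquad \text{for all } x, y \in X,$$ where $\|\cdot\|$ is the Euclidean norm. Then $$(1-\epsilon)\,\omega(X) \le \omega(S) \le (1+\epsilon)\,\omega(X).$$ -/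

import Mathlib

open MeasureTheory ProbabilityTheory

/-- The Gaussian width `ω(S) = E_g [sup_{v ∈ S} ⟨g, v⟩]` of a set `S ⊆ ℝ^d`, where `g` is a vector
of `d` independent standard normal variables. -/
noncomputable def gaussianWidth {d : ℕ} (S : Set (EuclideanSpace ℝ (Fin d))) : ℝ :=
  ∫ g, (⨆ v : S, inner ℝ g (v : EuclideanSpace ℝ (Fin d)))
    ∂(stdGaussian (EuclideanSpace ℝ (Fin d)))

/-- `S ⊆ ℝ^d` is an `ε`-isometric embedding of `X ⊆ ℝ^m`: it is the image of `X` under a map `ψ`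
that preserves the Euclidean distance of any two points of `X` up to a factor in
`[1 - ε, 1 + ε]`. -/
def IsIsometricEmbedding {m d : ℕ} (ε : ℝ) (X : Set (EuclideanSpace ℝ (Fin m)))
    (S : Set (EuclideanSpace ℝ (Fin d))) : Prop :=
  ∃ ψ : X → EuclideanSpace ℝ (Fin d), Set.range ψ = S ∧
    ∀ x y : X, (1 - ε) * ‖(x : EuclideanSpace ℝ (Fin m)) - y‖ ≤ ‖ψ x - ψ y‖ ∧
      ‖ψ x - ψ y‖ ≤ (1 + ε) * ‖(x : EuclideanSpace ℝ (Fin m)) - y‖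

/-! ### Log-sum-exp as a smooth maximum, expanded to second order. -/

section SoftMax

variable {ι : Type*} [Fintype ι]

/-! The result follows from the Sudakov–Fernique inequality (`familyWidth_le_of_norm_sub_le`), which
compares `ψ` with the rescaled families `(1 ± ε) • x`.

That inequality is proved without differentiating along an interpolation. The maximum is replaced by
log-sum-exp, whose second-order term under a centred perturbation is a nonnegative combination of
the increment variances `E (w i - w j) ^ 2`. A Gaussian vector is a sum of `n` independent copies of
itself scaled by `1 / √n`; exchanging these one by one, as in Lindeberg's method, costs `O(n ^
(-3/2))` each, hence nothing in the limit (`integral_logSumExp_le`). Scaling both families up then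
removes the `log card` smoothing error. -/

theorem abs_log_sum_exp_sub_half_variance_le {p w : ι → ℝ} {M : ℝ} (hp : ∀ i, 0 ≤ p i)
    (hp1 : ∑ i, p i = 1) (hw : ∀ i, |w i| ≤ M) (hc : ∑ i, p i * w i = 0) :
    |Real.log (∑ i, p i * Real.exp (w i)) - (∑ i, p i * w i ^ 2) / 2| ≤ M ^ 3 := by
  set S := ∑ i, p i * Real.exp (w i)
  set V := ∑ i, p i * w i ^ 2
  have hne : Nonempty ι := by
    by_contra h
    rw [not_nonempty_iff] at h
    simp at hp1
  have hM : 0 ≤ M := (abs_nonneg _).trans (hw hne.some)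
  have hV0 : 0 ≤ V := Finset.sum_nonneg fun i _ ↦ mul_nonneg (hp i) (sq_nonneg _)
  have hVM : V ≤ M ^ 2 := by
    calc V ≤ ∑ i, p i * M ^ 2 := Finset.sum_le_sum fun i _ ↦
          mul_le_mul_of_nonneg_left (sq_le_sq' (abs_le.1 (hw i)).1 (abs_le.1 (hw i)).2) (hp i)
      _ = M ^ 2 := by rw [← Finset.sum_mul, hp1, one_mul]
  have hS1 : 1 ≤ S := by
    calc (1 : ℝ) = ∑ i, p i * (w i + 1) := by simp [mul_add, Finset.sum_add_distrib, hc, hp1]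
      _ ≤ S := Finset.sum_le_sum fun i _ ↦
          mul_le_mul_of_nonneg_left (Real.add_one_le_exp _) (hp i)
  have hlog0 : 0 ≤ Real.log S := Real.log_nonneg hS1
  -- For `M ≤ 1`, Taylor expansion gives an error of at most `2/9 * M ^ 3 + M ^ 4 / 2`. For `M > 1`,
  -- both `log S ≤ M` and `V / 2 ≤ M ^ 2 / 2` are already below `M ^ 3`.
  rcases le_or_gt M 1 with hM1 | hM1
  · have hu : |S - 1 - V / 2| ≤ 2 / 9 * M ^ 3 := by
      have h1 : S - 1 - V / 2 = ∑ i, p i * (Real.exp (w i) - (1 + w i + w i ^ 2 / 2)) := by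
        simp only [mul_sub, mul_add, Finset.sum_sub_distrib, Finset.sum_add_distrib, mul_one,
          hp1, hc, S, V, Finset.sum_div, mul_div_assoc]
        ring
      rw [h1]
      calc _ ≤ ∑ i, |p i * (Real.exp (w i) - (1 + w i + w i ^ 2 / 2))| :=
            Finset.abs_sum_le_sum_abs _ _
        _ ≤ ∑ i, p i * (2 / 9 * M ^ 3) := by
            refine Finset.sum_le_sum fun i _ ↦ ?_
            rw [abs_mul, abs_of_nonneg (hp i)]
            refine mul_le_mul_of_nonneg_left ?_ (hp i)
            have h2 := Real.exp_bound ((hw i).trans hM1) (n := 3) (by norm_num)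
            norm_num [Finset.sum_range_succ, Nat.factorial] at h2
            calc _ ≤ |w i| ^ 3 * (2 / 9) := h2
              _ ≤ M ^ 3 * (2 / 9) := by gcongr; exact hw i
              _ = _ := by ring
        _ = _ := by rw [← Finset.sum_mul, hp1, one_mul]
    obtain ⟨hu1, hu2⟩ := abs_le.1 hu
    have hM32 : M ^ 3 ≤ M ^ 2 := pow_le_pow_of_le_one hM hM1 (by norm_num)
    have hM43 : M ^ 4 ≤ M ^ 3 := pow_le_pow_of_le_one hM hM1 (by norm_num)
    have hM3 : 0 ≤ M ^ 3 := by positivity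
    have hle : Real.log S ≤ S - 1 := Real.log_le_sub_one_of_pos (by linarith)
    have hge : S - 1 - (S - 1) ^ 2 / 2 ≤ Real.log S := by
      have h := Real.le_log_one_add_of_nonneg (x := S - 1) (by linarith)
      rw [show 1 + (S - 1) = S by ring] at h
      refine le_trans ?_ h
      rw [le_div_iff₀ (by linarith)]
      nlinarith [pow_nonneg (sub_nonneg.2 hS1) 3]
    have hsq : (S - 1) ^ 2 ≤ M ^ 4 := by
      calc (S - 1) ^ 2 ≤ (M ^ 2) ^ 2 := pow_le_pow_left₀ (by linarith) (by linarith) 2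
        _ = _ := by ring
    rw [abs_le]
    constructor <;> linarith
  · have hlogM : Real.log S ≤ M := by
      rw [Real.log_le_iff_le_exp (by linarith)]
      calc S ≤ ∑ i, p i * Real.exp M := Finset.sum_le_sum fun i _ ↦
            mul_le_mul_of_nonneg_left (Real.exp_le_exp.2 (abs_le.1 (hw i)).2) (hp i)
        _ = _ := by rw [← Finset.sum_mul, hp1, one_mul]
    have h13 : M ≤ M ^ 3 := le_self_pow₀ hM1.le (by norm_num)
    have h23 : M ^ 2 ≤ M ^ 3 := pow_le_pow_right₀ hM1.le (by norm_num)
    rw [abs_le]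
    constructor <;> linarith

/-- Second-order expansion of the cumulant generating function of a finite distribution, with an
explicit remainder. -/
theorem abs_log_sum_exp_sub_quadratic_le {p w : ι → ℝ} {B : ℝ} (hp : ∀ i, 0 ≤ p i)
    (hp1 : ∑ i, p i = 1) (hw : ∀ i, |w i| ≤ B) :
    |Real.log (∑ i, p i * Real.exp (w i)) -
      (∑ i, p i * w i + (∑ i, ∑ j, p i * p j * (w i - w j) ^ 2) / 4)| ≤ 8 * B ^ 3 := by
  set m := ∑ i, p i * w i
  have hm : |m| ≤ B := by
    calc |m| ≤ ∑ i, |p i * w i| := Finset.abs_sum_le_sum_abs _ _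
      _ ≤ ∑ i, p i * B := Finset.sum_le_sum fun i _ ↦ by
          rw [abs_mul, abs_of_nonneg (hp i)]
          exact mul_le_mul_of_nonneg_left (hw i) (hp i)
      _ = B := by rw [← Finset.sum_mul, hp1, one_mul]
  have hc : ∑ i, p i * (w i - m) = 0 := by
    simp only [mul_sub, Finset.sum_sub_distrib, ← Finset.sum_mul, hp1, one_mul]
    exact sub_self m
  -- Centring at the mean at most doubles the bound, whence `8 = 2 ^ 3`.
  have h := abs_log_sum_exp_sub_half_variance_le (w := fun i ↦ w i - m) (M := 2 * B) hp hp1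
    (fun i ↦ (abs_sub _ _).trans (by linarith [hw i])) hc
  have hpos : ∑ i, p i * Real.exp (w i) ≠ 0 := by
    have : ∃ i, 0 < p i := by
      by_contra! hcon
      have : ∑ i, p i ≤ 0 := Finset.sum_nonpos fun i _ ↦ hcon i
      linarith
    obtain ⟨i, hi⟩ := this
    refine (Finset.sum_pos' (fun j _ ↦ mul_nonneg (hp j) (Real.exp_pos _).le)
      ⟨i, Finset.mem_univ _, mul_pos hi (Real.exp_pos _)⟩).ne'
  have hlog : Real.log (∑ i, p i * Real.exp (w i - m)) =
      Real.log (∑ i, p i * Real.exp (w i)) - m := by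
    simp only [Real.exp_sub, ← mul_div_assoc, ← Finset.sum_div]
    rw [Real.log_div hpos (Real.exp_pos _).ne', Real.log_exp]
  -- Writing the variance over pairs makes only the increments of `w` appear.
  have hvar : ∑ i, ∑ j, p i * p j * (w i - w j) ^ 2 = 2 * ∑ i, p i * (w i - m) ^ 2 := by
    have h1 (i j : ι) : p i * p j * (w i - w j) ^ 2 = p j * (p i * (w i - m) ^ 2)
        - 2 * ((p i * (w i - m)) * (p j * (w j - m))) + p i * (p j * (w j - m) ^ 2) := by ring
    simp only [h1, Finset.sum_add_distrib, Finset.sum_sub_distrib, ← Finset.mul_sum,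
      ← Finset.sum_mul, hc, hp1]
    ring
  rw [hlog] at h
  rw [hvar]
  calc _ = _ := by congr 1; ring
    _ ≤ _ := h
    _ = _ := by ring

noncomputable def logSumExp (z : ι → ℝ) : ℝ := Real.log (∑ i, Real.exp (z i))

noncomputable def softmax (z : ι → ℝ) (i : ι) : ℝ := Real.exp (z i) / ∑ j, Real.exp (z j)

theorem softmax_nonneg (z : ι → ℝ) (i : ι) : 0 ≤ softmax z i := by
  unfold softmax; positivity

variable [Nonempty ι]

theorem sum_exp_pos (z : ι → ℝ) : 0 < ∑ i, Real.exp (z i) :=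
  Finset.sum_pos (fun _ _ ↦ Real.exp_pos _) Finset.univ_nonempty

theorem sum_softmax (z : ι → ℝ) : ∑ i, softmax z i = 1 := by
  simp only [softmax, ← Finset.sum_div]
  exact div_self (sum_exp_pos z).ne'

theorem logSumExp_add (z w : ι → ℝ) :
    logSumExp (z + w) = logSumExp z + Real.log (∑ i, softmax z i * Real.exp (w i)) := by
  have h : ∑ i, softmax z i * Real.exp (w i) =
      (∑ i, Real.exp ((z + w) i)) / ∑ i, Real.exp (z i) := by
    simp only [softmax, Finset.sum_div, Pi.add_apply, Real.exp_add]
    exact Finset.sum_congr rfl fun i _ ↦ by ring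
  rw [h, Real.log_div (sum_exp_pos _).ne' (sum_exp_pos _).ne']
  simp [logSumExp]

theorem logSumExp_le_add_norm (x y : ι → ℝ) : logSumExp x ≤ logSumExp y + ‖x - y‖ := by
  unfold logSumExp
  rw [Real.log_le_iff_le_exp (sum_exp_pos _), Real.exp_add, Real.exp_log (sum_exp_pos _),
    Finset.sum_mul]
  refine Finset.sum_le_sum fun i _ ↦ ?_
  rw [← Real.exp_add, Real.exp_le_exp]
  have := (Real.le_norm_self _).trans (norm_le_pi_norm (x - y) i)
  simp only [Pi.sub_apply] at this
  linarith

theorem lipschitzWith_logSumExp : LipschitzWith 1 (logSumExp : (ι → ℝ) → ℝ) :=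
  LipschitzWith.of_le_add fun x y ↦ by
    rw [dist_eq_norm]; exact logSumExp_le_add_norm x y

theorem le_logSumExp (z : ι → ℝ) (i : ι) : z i ≤ logSumExp z := by
  unfold logSumExp
  rw [Real.le_log_iff_exp_le (sum_exp_pos _)]
  exact Finset.single_le_sum (f := fun i ↦ Real.exp (z i)) (fun j _ ↦ (Real.exp_pos _).le)
    (Finset.mem_univ i)

theorem iSup_le_logSumExp (z : ι → ℝ) : ⨆ i, z i ≤ logSumExp z :=
  ciSup_le (le_logSumExp z)

theorem logSumExp_le_iSup_add (z : ι → ℝ) :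
    logSumExp z ≤ (⨆ i, z i) + Real.log (Fintype.card ι) := by
  have hc : (0 : ℝ) < Fintype.card ι := by exact_mod_cast Fintype.card_pos
  unfold logSumExp
  rw [Real.log_le_iff_le_exp (sum_exp_pos _), Real.exp_add, Real.exp_log hc]
  calc _ ≤ ∑ _i : ι, Real.exp (⨆ i, z i) := Finset.sum_le_sum fun i _ ↦
        Real.exp_le_exp.2 (le_ciSup (Finite.bddAbove_range z) i)
    _ = _ := by simp [mul_comm]

theorem abs_logSumExp_add_sub_le (z w : ι → ℝ) :
    |logSumExp (z + w) - (logSumExp z + (∑ i, softmax z i * w i +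
      (∑ i, ∑ j, softmax z i * softmax z j * (w i - w j) ^ 2) / 4))| ≤ 8 * ‖w‖ ^ 3 := by
  rw [logSumExp_add, add_sub_add_left_eq_sub]
  exact abs_log_sum_exp_sub_quadratic_le (softmax_nonneg z) (sum_softmax z)
    fun i ↦ norm_le_pi_norm w i

end SoftMax

/-! ### Integrability and rotation invariance of Gaussian measures. -/

section Gaussian

variable {E : Type*} [NormedAddCommGroup E] [NormedSpace ℝ E] [MeasurableSpace E] [BorelSpace E]
  [SecondCountableTopology E] [CompleteSpace E]

theorem LipschitzWith.integrable_of_isGaussian {μ : Measure E} [IsGaussian μ] {f : E → ℝ}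
    {K : NNReal} (hf : LipschitzWith K f) : Integrable f μ := by
  have hn : Integrable (fun x : E ↦ ‖x‖) μ := IsGaussian.integrable_id.norm
  refine ((integrable_const |f 0|).add (hn.const_mul (K : ℝ))).mono'
    hf.continuous.aestronglyMeasurable (ae_of_all _ fun x ↦ ?_)
  have h := hf.dist_le_mul x 0
  rw [dist_zero_right, Real.dist_eq] at h
  have h2 := abs_sub_abs_le_abs_sub (f x) (f 0)
  simp only [Real.norm_eq_abs, Pi.add_apply]
  linarith

/-- Stability of centred Gaussian measures under independent sums. -/
theorem integral_sqrt_smul_of_isGaussian {μ : Measure E} [IsGaussian μ] (hμ : μ[id] = 0)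
    {f : E → ℝ} {K : NNReal} (hf : LipschitzWith K f) (a b : ℝ) :
    ∫ x, f (√(a ^ 2 + b ^ 2) • x) ∂μ = ∫ x, ∫ y, f (a • x + b • y) ∂μ ∂μ := by
  -- The argument of `a + bi` is the angle of the rotation, which preserves `μ.prod μ`.
  set z : ℂ := ⟨a, b⟩
  have hz : ‖z‖ = √(a ^ 2 + b ^ 2) := by
    rw [Complex.norm_def, Complex.normSq_apply]; congr 1; simp only [z]; ring
  have ha : √(a ^ 2 + b ^ 2) * Real.cos z.arg = a := by rw [← hz, Complex.norm_mul_cos_arg]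
  have hb : √(a ^ 2 + b ^ 2) * Real.sin z.arg = b := by rw [← hz, Complex.norm_mul_sin_arg]
  have hfL (L : E × E →L[ℝ] E) : Integrable (fun p ↦ f (L p)) (μ.prod μ) :=
    (hf.comp L.lipschitz).integrable_of_isGaussian
  have hrot := IsGaussian.map_rotation_eq_self hμ z.arg
  calc ∫ x, f (√(a ^ 2 + b ^ 2) • x) ∂μ
      = ∫ p : E × E, f (√(a ^ 2 + b ^ 2) • p.1) ∂(μ.prod μ) := by
        rw [integral_fun_fst (fun x ↦ f (√(a ^ 2 + b ^ 2) • x))]; simp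
    _ = ∫ p : E × E, f (√(a ^ 2 + b ^ 2) • (ContinuousLinearMap.rotation z.arg p).1)
          ∂(μ.prod μ) := by
        conv_lhs => rw [← hrot]
        rw [integral_map (by fun_prop)]
        exact (hf.continuous.comp (by fun_prop)).aestronglyMeasurable
    _ = ∫ p : E × E, f (a • p.1 + b • p.2) ∂(μ.prod μ) := by
        refine integral_congr_ae (ae_of_all _ fun p ↦ ?_)
        simp only [ContinuousLinearMap.rotation_apply, smul_add, smul_smul, ha, hb]
    _ = _ := integral_prod _ (hfL (a • .fst ℝ E E + b • .snd ℝ E E))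

end Gaussian

/-! ### Lindeberg comparison of two centred Gaussian vectors. -/

section Comparison

variable {ι : Type*} [Fintype ι] {μ ν : Measure (ι → ℝ)} [IsGaussian μ] [IsGaussian ν]

theorem integrable_norm_pow_three : Integrable (fun w : ι → ℝ ↦ ‖w‖ ^ 3) μ := by
  simpa using (IsGaussian.memLp_id μ 3 (by norm_num)).integrable_norm_pow (by norm_num)

theorem integrable_sub_sq (i j : ι) : Integrable (fun w : ι → ℝ ↦ (w i - w j) ^ 2) μ :=
  (IsGaussian.memLp_dual μ (.proj (R := ℝ) (φ := fun _ : ι ↦ ℝ) i - .proj j) 2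
    (by norm_num)).integrable_sq

variable [Nonempty ι]

theorem lipschitzWith_logSumExp_add (z : ι → ℝ) : LipschitzWith 1 fun w ↦ logSumExp (z + w) :=
  LipschitzWith.of_le_add fun x y ↦ by
    simpa [dist_eq_norm] using logSumExp_le_add_norm (z + x) (z + y)

theorem integrable_logSumExp_add_smul (z : ι → ℝ) (s : ℝ) :
    Integrable (fun w ↦ logSumExp (z + s • w)) μ :=
  ((lipschitzWith_logSumExp_add z).comp (lipschitzWith_smul s)).integrable_of_isGaussian

theorem integrable_logSumExp_add_smul_add_smul (z : ι → ℝ) (a b : ℝ) :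
    Integrable (fun p : (ι → ℝ) × (ι → ℝ) ↦ logSumExp (z + a • p.1 + b • p.2)) (μ.prod ν) := by
  have h := ((lipschitzWith_logSumExp_add z).comp (a • ContinuousLinearMap.fst ℝ (ι → ℝ) (ι → ℝ) +
    b • ContinuousLinearMap.snd ℝ (ι → ℝ) (ι → ℝ)).lipschitz).integrable_of_isGaussian
      (μ := μ.prod ν)
  simp only [add_assoc]
  exact h

theorem integral_logSumExp_add_sqrt_smul (hμ : μ[id] = 0) (z : ι → ℝ) (a b : ℝ) :
    ∫ w, logSumExp (z + √(a ^ 2 + b ^ 2) • w) ∂μ =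
      ∫ x, ∫ y, logSumExp (z + a • x + b • y) ∂μ ∂μ := by
  simp only [add_assoc]
  exact integral_sqrt_smul_of_isGaussian hμ (lipschitzWith_logSumExp_add z) a b

/-- The pointwise expansion is integrated; its linear term vanishes because `μ` is centred. -/
theorem abs_integral_logSumExp_sub_le (hμ : μ[id] = 0) (z : ι → ℝ) {s : ℝ} (hs : 0 ≤ s) :
    |∫ w, logSumExp (z + s • w) ∂μ - (logSumExp z + s ^ 2 / 4 *
      ∑ i, ∑ j, softmax z i * softmax z j * ∫ w, (w i - w j) ^ 2 ∂μ)| ≤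
      8 * s ^ 3 * ∫ w, ‖w‖ ^ 3 ∂μ := by
  set q : (ι → ℝ) → ℝ := fun w ↦ ∑ i, ∑ j, softmax z i * softmax z j * (w i - w j) ^ 2
  set l : (ι → ℝ) → ℝ := fun w ↦ ∑ i, softmax z i * w i
  have hq : Integrable q μ := integrable_finsetSum _ fun i _ ↦ integrable_finsetSum _ fun j _ ↦
    (integrable_sub_sq i j).const_mul _
  have hev (i : ι) : Integrable (fun w : ι → ℝ ↦ w i) μ :=
    IsGaussian.integrable_dual μ (.proj (R := ℝ) (φ := fun _ : ι ↦ ℝ) i)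
  have hl : Integrable l μ := integrable_finsetSum _ fun i _ ↦ (hev i).const_mul _
  have hl0 : ∫ w, l w ∂μ = 0 := by
    rw [integral_finsetSum _ fun i _ ↦ (hev i).const_mul _]
    refine Finset.sum_eq_zero fun i _ ↦ ?_
    have h := IsGaussian.integral_dual (μ := μ) (.proj (R := ℝ) (φ := fun _ : ι ↦ ℝ) i)
    have hμ' : ∫ x, x ∂μ = 0 := hμ
    rw [hμ', map_zero] at h
    rw [integral_const_mul]
    simp only [ContinuousLinearMap.proj_apply] at h
    rw [h, mul_zero]
  have hqi : ∫ w, q w ∂μ =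
      ∑ i, ∑ j, softmax z i * softmax z j * ∫ w, (w i - w j) ^ 2 ∂μ := by
    rw [integral_finsetSum _ fun i _ ↦ integrable_finsetSum _ fun j _ ↦
      (integrable_sub_sq i j).const_mul _]
    refine Finset.sum_congr rfl fun i _ ↦ ?_
    rw [integral_finsetSum _ fun j _ ↦ (integrable_sub_sq i j).const_mul _]
    simp only [integral_const_mul]
  have hpt (w : ι → ℝ) : ‖logSumExp (z + s • w) - (logSumExp z + (s * l w + s ^ 2 / 4 * q w))‖ ≤
      8 * s ^ 3 * ‖w‖ ^ 3 := by
    have h := abs_logSumExp_add_sub_le z (s • w)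
    rw [norm_smul, Real.norm_of_nonneg hs] at h
    rw [Real.norm_eq_abs]
    convert h using 1
    · simp only [l, q, Pi.smul_apply, smul_eq_mul, ← mul_sub, mul_pow, Finset.mul_sum,
        Finset.sum_div]
      congr 4
      · exact Finset.sum_congr rfl fun i _ ↦ by ring
      · exact Finset.sum_congr rfl fun i _ ↦ Finset.sum_congr rfl fun j _ ↦ by ring
    · ring
  have hI : Integrable (fun w ↦ logSumExp z + (s * l w + s ^ 2 / 4 * q w)) μ :=
    (integrable_const _).add ((hl.const_mul _).add (hq.const_mul _))
  have hIv : ∫ w, logSumExp z + (s * l w + s ^ 2 / 4 * q w) ∂μ =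
      logSumExp z + s ^ 2 / 4 * ∫ w, q w ∂μ := by
    rw [integral_add (g := fun w ↦ s * l w + s ^ 2 / 4 * q w) (integrable_const _)
      ((hl.const_mul _).add (hq.const_mul _)), integral_add (hl.const_mul _) (hq.const_mul _), integral_const_mul, integral_const_mul, hl0]
    simp
  rw [← hqi, ← hIv, ← integral_sub (integrable_logSumExp_add_smul z s) hI, ← integral_const_mul,
    ← Real.norm_eq_abs]
  exact norm_integral_le_of_norm_le (integrable_norm_pow_three.const_mul _) (ae_of_all _ hpt)

theorem integral_logSumExp_le_add_pow_three (hμ : μ[id] = 0) (hν : ν[id] = 0)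
    (h : ∀ i j, ∫ w, (w i - w j) ^ 2 ∂ν ≤ ∫ w, (w i - w j) ^ 2 ∂μ) (z : ι → ℝ) {s : ℝ}
    (hs : 0 ≤ s) :
    ∫ w, logSumExp (z + s • w) ∂ν ≤ ∫ w, logSumExp (z + s • w) ∂μ +
      8 * (∫ w, ‖w‖ ^ 3 ∂μ + ∫ w, ‖w‖ ^ 3 ∂ν) * s ^ 3 := by
  have h1 := (abs_le.1 (abs_integral_logSumExp_sub_le hμ z hs)).1
  have h2 := (abs_le.1 (abs_integral_logSumExp_sub_le hν z hs)).2
  have h3 : s ^ 2 / 4 * ∑ i, ∑ j, softmax z i * softmax z j * ∫ w, (w i - w j) ^ 2 ∂ν ≤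
      s ^ 2 / 4 * ∑ i, ∑ j, softmax z i * softmax z j * ∫ w, (w i - w j) ^ 2 ∂μ := by
    exact mul_le_mul_of_nonneg_left (Finset.sum_le_sum fun i _ ↦ Finset.sum_le_sum fun j _ ↦
      mul_le_mul_of_nonneg_left (h i j) (mul_nonneg (softmax_nonneg z i) (softmax_nonneg z j)))
      (by positivity)
  linarith

/-- Induction on the number of pieces of scale `s`, for all shifts `z` at once, since the pieces not
being exchanged act as a shift. -/
theorem integral_logSumExp_sqrt_nat_le (hμ : μ[id] = 0) (hν : ν[id] = 0)
    (h : ∀ i j, ∫ w, (w i - w j) ^ 2 ∂ν ≤ ∫ w, (w i - w j) ^ 2 ∂μ) {s : ℝ}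
    (hs : 0 ≤ s) (n : ℕ) (z : ι → ℝ) :
    ∫ w, logSumExp (z + (√n * s) • w) ∂ν ≤ ∫ w, logSumExp (z + (√n * s) • w) ∂μ +
      n * (8 * (∫ w, ‖w‖ ^ 3 ∂μ + ∫ w, ‖w‖ ^ 3 ∂ν) * s ^ 3) := by
  set C := 8 * (∫ w, ‖w‖ ^ 3 ∂μ + ∫ w, ‖w‖ ^ 3 ∂ν) * s ^ 3
  induction n generalizing z with
  | zero => simp
  | succ n ih =>
    have hsqrt : √((n + 1 : ℕ) : ℝ) * s = √(s ^ 2 + (√n * s) ^ 2) := by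
      rw [mul_pow, Real.sq_sqrt n.cast_nonneg, show s ^ 2 + n * s ^ 2 = ((n + 1 : ℕ) : ℝ) * s ^ 2 by
        push_cast; ring, Real.sqrt_mul (by positivity), Real.sqrt_sq hs]
    rw [hsqrt]
    calc ∫ w, logSumExp (z + √(s ^ 2 + (√n * s) ^ 2) • w) ∂ν
        = ∫ x, ∫ y, logSumExp (z + s • x + (√n * s) • y) ∂ν ∂ν := integral_logSumExp_add_sqrt_smul hν _ _ _
      _ ≤ ∫ x, (∫ y, logSumExp (z + s • x + (√n * s) • y) ∂μ + n * C) ∂ν :=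
          integral_mono (integrable_logSumExp_add_smul_add_smul z _ _).integral_prod_left
            ((integrable_logSumExp_add_smul_add_smul z _ _).integral_prod_left.add
              (integrable_const _)) fun x ↦ ih _
      _ = ∫ x, ∫ y, logSumExp (z + s • x + (√n * s) • y) ∂μ ∂ν + n * C := by
          rw [integral_add (integrable_logSumExp_add_smul_add_smul z _ _).integral_prod_left
            (integrable_const _)]
          simp
      -- Fubini makes the exchanged `μ` part the shift, leaving one `ν` piece to replace.
      _ = ∫ y, ∫ x, logSumExp (z + (√n * s) • y + s • x) ∂ν ∂μ + n * C := by
          rw [integral_integral_swap (integrable_logSumExp_add_smul_add_smul z _ _)]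
          simp only [add_right_comm]
      _ ≤ ∫ y, (∫ x, logSumExp (z + (√n * s) • y + s • x) ∂μ + C) ∂μ + n * C := by
          refine add_le_add (integral_mono ?_ ?_ fun y ↦ integral_logSumExp_le_add_pow_three hμ hν h _ hs) le_rfl
          · exact (integrable_logSumExp_add_smul_add_smul z _ _).integral_prod_left
          · exact (integrable_logSumExp_add_smul_add_smul z _ _).integral_prod_left.add
              (integrable_const _)
      _ = ∫ y, ∫ x, logSumExp (z + (√n * s) • y + s • x) ∂μ ∂μ + ((n + 1 : ℕ) : ℝ) * C := by
          rw [integral_add (integrable_logSumExp_add_smul_add_smul z _ _).integral_prod_left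
            (integrable_const _)]
          simp
          ring
      _ = _ := by rw [← integral_logSumExp_add_sqrt_smul hμ, add_comm (s ^ 2)]

theorem integral_logSumExp_le (hμ : μ[id] = 0) (hν : ν[id] = 0)
    (h : ∀ i j, ∫ w, (w i - w j) ^ 2 ∂ν ≤ ∫ w, (w i - w j) ^ 2 ∂μ) :
    ∫ w, logSumExp w ∂ν ≤ ∫ w, logSumExp w ∂μ := by
  set C := 8 * (∫ w, ‖w‖ ^ 3 ∂μ + ∫ w, ‖w‖ ^ 3 ∂ν)
  have hlim : Filter.Tendsto (fun n : ℕ ↦ ∫ w, logSumExp w ∂μ + C * (√(n : ℝ))⁻¹) Filter.atTop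
      (nhds (∫ w, logSumExp w ∂μ)) := by
    have h1 : Filter.Tendsto (fun n : ℕ ↦ (√(n : ℝ))⁻¹) Filter.atTop (nhds 0) :=
      (Real.tendsto_sqrt_atTop.comp tendsto_natCast_atTop_atTop).inv_tendsto_atTop
    simpa using (h1.const_mul C).const_add (∫ w, logSumExp w ∂μ)
  refine ge_of_tendsto hlim (Filter.eventually_atTop.2 ⟨1, fun n hn ↦ ?_⟩)
  have hn0 : 0 < √(n : ℝ) := Real.sqrt_pos.2 (by exact_mod_cast hn)
  -- With `s = 1 / √n` the total error is `n * C * s ^ 3 = C / √n`.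
  have h1 := integral_logSumExp_sqrt_nat_le hμ hν h (inv_nonneg.2 hn0.le) n 0
  rw [mul_inv_cancel₀ hn0.ne'] at h1
  simp only [one_smul, zero_add] at h1
  refine h1.trans_eq ?_
  congr 1
  have hnn : (n : ℝ) = √n * √n := (Real.mul_self_sqrt n.cast_nonneg).symm
  change (n : ℝ) * (C * _) = _
  calc (n : ℝ) * (C * (√(n : ℝ))⁻¹ ^ 3) = (√n * √n) * (C * (√(n : ℝ))⁻¹ ^ 3) := by rw [← hnn]
    _ = _ := by field_simp

end Comparison

/-! ### Gaussian width of families and the Sudakov–Fernique inequality. -/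

section Width

variable {ι : Type*} {E F : Type*}
  [NormedAddCommGroup E] [InnerProductSpace ℝ E] [FiniteDimensional ℝ E] [MeasurableSpace E]
  [BorelSpace E]
  [NormedAddCommGroup F] [InnerProductSpace ℝ F] [FiniteDimensional ℝ F] [MeasurableSpace F]
  [BorelSpace F]

/-- The Gaussian width of an indexed family of vectors. -/
noncomputable def familyWidth (u : ι → E) : ℝ := ∫ g, ⨆ i, inner ℝ g (u i) ∂(stdGaussian E)

theorem familyWidth_smul (u : ι → E) {c : ℝ} (hc : 0 ≤ c) :
    familyWidth (fun i ↦ c • u i) = c * familyWidth u := by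
  simp only [familyWidth, real_inner_smul_right, ← Real.mul_iSup_of_nonneg hc, integral_const_mul]

theorem familyWidth_zero : familyWidth (fun _ : ι ↦ (0 : E)) = 0 := by
  simp [familyWidth]

/-- The linear map sending `g` to the values of the Gaussian process indexed by `u`. -/
noncomputable def innerFamily (u : ι → E) : E →L[ℝ] (ι → ℝ) :=
  ContinuousLinearMap.pi fun i ↦ innerSL ℝ (u i)

theorem innerFamily_apply (u : ι → E) (g : E) (i : ι) : innerFamily u g i = inner ℝ g (u i) :=
  real_inner_comm _ _

theorem integral_inner_sq_stdGaussian (v : E) :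
    ∫ g, inner ℝ g v ^ 2 ∂(stdGaussian E) = ‖v‖ ^ 2 := by
  have h := variance_dual_stdGaussian (innerSL ℝ v)
  rw [variance_of_integral_eq_zero (by fun_prop) (integral_strongDual_stdGaussian _),
    innerSL_apply_norm] at h
  simpa [real_inner_comm] using h

variable [Fintype ι]

theorem integral_id_map_innerFamily (u : ι → E) :
    ((stdGaussian E).map (innerFamily u))[id] = 0 := by
  rw [integral_map (by fun_prop) (by fun_prop)]
  simp only [id]
  rw [(innerFamily u).integral_comp_id_comm IsGaussian.integrable_id, integral_id_stdGaussian,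
    map_zero]

theorem integral_sub_sq_map_innerFamily (u : ι → E) (i j : ι) :
    ∫ w, (w i - w j) ^ 2 ∂((stdGaussian E).map (innerFamily u)) = ‖u i - u j‖ ^ 2 := by
  rw [integral_map (by fun_prop) (by fun_prop), ← integral_inner_sq_stdGaussian]
  simp only [innerFamily_apply, inner_sub_right]

variable [Nonempty ι]

theorem integral_logSumExp_inner_le {u : ι → E} {v : ι → F}
    (h : ∀ i j, ‖v i - v j‖ ≤ ‖u i - u j‖) :
    ∫ g, logSumExp (fun i ↦ inner ℝ g (v i)) ∂(stdGaussian F) ≤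
      ∫ g, logSumExp (fun i ↦ inner ℝ g (u i)) ∂(stdGaussian E) := by
  have key := integral_logSumExp_le (μ := (stdGaussian E).map (innerFamily u))
    (ν := (stdGaussian F).map (innerFamily v)) (integral_id_map_innerFamily u)
    (integral_id_map_innerFamily v) fun i j ↦ by
      rw [integral_sub_sq_map_innerFamily, integral_sub_sq_map_innerFamily]
      exact pow_le_pow_left₀ (norm_nonneg _) (h i j) 2
  rw [integral_map (by fun_prop) lipschitzWith_logSumExp.continuous.aestronglyMeasurable,
    integral_map (by fun_prop) lipschitzWith_logSumExp.continuous.aestronglyMeasurable] at key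
  simpa only [← innerFamily_apply] using key

theorem integrable_logSumExp_inner (u : ι → E) :
    Integrable (fun g ↦ logSumExp (fun i ↦ inner ℝ g (u i))) (stdGaussian E) := by
  simp only [← innerFamily_apply]
  exact (lipschitzWith_logSumExp.comp (innerFamily u).lipschitz).integrable_of_isGaussian

theorem integrable_iSup_inner (u : ι → E) :
    Integrable (fun g ↦ ⨆ i, inner ℝ g (u i)) (stdGaussian E) := by
  have hm : Measurable fun g : E ↦ ⨆ i, inner ℝ g (u i) := Measurable.iSup fun i ↦ by fun_prop
  refine integrable_of_le_of_le hm.aestronglyMeasurable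
    (ae_of_all _ fun g ↦ sub_le_iff_le_add.2 (logSumExp_le_iSup_add fun i ↦ inner ℝ g (u i)))
    (ae_of_all _ fun g ↦ iSup_le_logSumExp fun i ↦ inner ℝ g (u i))
    ((integrable_logSumExp_inner u).sub (integrable_const _)) (integrable_logSumExp_inner u)

theorem familyWidth_le_add_log_card {u : ι → E} {v : ι → F}
    (h : ∀ i j, ‖v i - v j‖ ≤ ‖u i - u j‖) :
    familyWidth v ≤ familyWidth u + Real.log (Fintype.card ι) := by
  calc familyWidth v ≤ ∫ g, logSumExp (fun i ↦ inner ℝ g (v i)) ∂(stdGaussian F) :=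
        integral_mono (integrable_iSup_inner v) (integrable_logSumExp_inner v)
          fun g ↦ iSup_le_logSumExp _
    _ ≤ ∫ g, logSumExp (fun i ↦ inner ℝ g (u i)) ∂(stdGaussian E) :=
        integral_logSumExp_inner_le h
    _ ≤ ∫ g, ((⨆ i, inner ℝ g (u i)) + Real.log (Fintype.card ι)) ∂(stdGaussian E) :=
        integral_mono (integrable_logSumExp_inner u)
          ((integrable_iSup_inner u).add (integrable_const _)) fun g ↦ logSumExp_le_iSup_add _
    _ = _ := by
        rw [integral_add (integrable_iSup_inner u) (integrable_const _)]
        simp [familyWidth]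

/-- The **Sudakov–Fernique inequality** for finite families of vectors. -/
theorem familyWidth_le_of_norm_sub_le {u : ι → E} {v : ι → F}
    (h : ∀ i j, ‖v i - v j‖ ≤ ‖u i - u j‖) : familyWidth v ≤ familyWidth u := by
  set K := Real.log (Fintype.card ι)
  have hlim : Filter.Tendsto (fun n : ℕ ↦ familyWidth u + K * (n : ℝ)⁻¹) Filter.atTop
      (nhds (familyWidth u)) := by
    simpa using ((tendsto_inv_atTop_nhds_zero_nat (𝕜 := ℝ)).const_mul K).const_add (familyWidth u)
  refine ge_of_tendsto hlim (Filter.eventually_atTop.2 ⟨1, fun n hn ↦ ?_⟩)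
  have hn0 : (0 : ℝ) < n := by exact_mod_cast hn
  -- Scaling by `n` multiplies both widths by `n` but leaves `log card` fixed.
  have h1 := familyWidth_le_add_log_card (u := fun i ↦ (n : ℝ) • u i) (v := fun i ↦ (n : ℝ) • v i)
    fun i j ↦ by
      rw [← smul_sub, ← smul_sub, norm_smul, norm_smul]
      exact mul_le_mul_of_nonneg_left (h i j) (norm_nonneg _)
  rw [familyWidth_smul _ hn0.le, familyWidth_smul _ hn0.le] at h1
  refine le_of_mul_le_mul_left (h1.trans_eq ?_) hn0
  field_simp
  rfl

theorem familyWidth_nonneg (u : ι → E) : 0 ≤ familyWidth u := by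
  rw [← familyWidth_zero (ι := ι) (E := E)]
  exact familyWidth_le_of_norm_sub_le fun i j ↦ by simp

theorem familyWidth_of_subsingleton [Subsingleton ι] (u : ι → E) : familyWidth u = 0 := by
  refine le_antisymm ?_ (familyWidth_nonneg u)
  rw [← familyWidth_zero (ι := ι) (E := E)]
  exact familyWidth_le_of_norm_sub_le fun i j ↦ by simp [Subsingleton.elim i j]

end Width

/-! ### Application to isometric embeddings. -/

theorem gaussianWidth_range {ι : Type*} {d : ℕ} (u : ι → EuclideanSpace ℝ (Fin d)) :
    gaussianWidth (Set.range u) = familyWidth u := by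
  unfold gaussianWidth familyWidth
  congr 1
  ext g
  exact (Set.rangeFactorization_surjective.iSup_comp
    (g := fun v : Set.range u ↦ inner ℝ g (v : EuclideanSpace ℝ (Fin d)))).symm

theorem lemma3p1 {m d : ℕ} (ε : ℝ) (X : Set (EuclideanSpace ℝ (Fin m)))
    (S : Set (EuclideanSpace ℝ (Fin d))) (hfin : X.Finite)
    (hX : X ⊆ Metric.sphere (0 : EuclideanSpace ℝ (Fin m)) 1)
    (hS : IsIsometricEmbedding ε X S) :
    (1 - ε) * gaussianWidth X ≤ gaussianWidth S ∧
      gaussianWidth S ≤ (1 + ε) * gaussianWidth X := by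
  obtain ⟨ψ, rfl, hψ⟩ := hS
  have hXw : gaussianWidth X = familyWidth (fun x : X ↦ (x : EuclideanSpace ℝ (Fin m))) := by
    rw [← gaussianWidth_range, Subtype.range_coe]
  rw [hXw, gaussianWidth_range]
  have := hfin.fintype
  rcases isEmpty_or_nonempty X with hE | hne
  · simp [familyWidth]
  -- A single point leaves the sign of `1 + ε` free, but both widths vanish; two distinct points
  -- force `1 + ε ≥ 0`.
  rcases subsingleton_or_nontrivial X with hsub | hnt
  · simp [familyWidth_of_subsingleton]
  obtain ⟨x, y, hxy⟩ := hnt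
  have hpos : 0 < ‖(x : EuclideanSpace ℝ (Fin m)) - y‖ :=
    norm_pos_iff.2 (sub_ne_zero.2 (Subtype.coe_injective.ne hxy))
  have hadd : 0 ≤ 1 + ε := by
    by_contra! hneg
    linarith [norm_nonneg (ψ x - ψ y), (hψ x y).2, mul_neg_of_neg_of_pos hneg hpos]
  constructor
  · rcases le_or_gt 0 (1 - ε) with hsub | hsub
    · rw [← familyWidth_smul _ hsub]
      refine familyWidth_le_of_norm_sub_le fun i j ↦ ?_
      rw [← smul_sub, norm_smul, Real.norm_of_nonneg hsub]
      exact (hψ i j).1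
    -- Here `1 - ε < 0`, so nonnegativity of the widths suffices.
    · exact (mul_nonpos_of_nonpos_of_nonneg hsub.le (familyWidth_nonneg _)).trans
        (familyWidth_nonneg _)
  · rw [← familyWidth_smul _ hadd]
    refine familyWidth_le_of_norm_sub_le fun i j ↦ ?_
    rw [← smul_sub, norm_smul, Real.norm_of_nonneg hadd]
    exact (hψ i j).2
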